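/- Let $X$ be a path-connected CW-space (a space admitting the structure of a CW complex) with base point $x_0$, let $\pi=\pi_1(X,x_0)$, let $\widetilde X$ be the universal cover of $X$, on which $\pi$ acts by deck transformations, and let $(C_*(\widetilde X),\partial)$ be its singular chain complex, a complex of left $\mathbb Z[\pi]$-modules. A local coefficient system on $X$ is a functor $\mathcal A$ from the fundamental groupoid of $X$ to abelian groups; its stalk $A$ at $x_0$ is a left $\mathbb Z[\pi]$-module, also regarded as a right module by $ag=g^{-1}a$. Put $$H_k(X;\mathcal A)=H_k\bigl(A\otimes_{\mathbb Z[\pi]}C_*(\widetilde X)\bigr),\qquad H^k(X;\mathcal A)=H^k\bigl(\operatorname{Hom}_{\mathbb Z[\pi]}(C_*(\widetilde X),A)\bigr),$$ and let $\cap: H_k(X;\mathcal A)\otimes H^k(X;\mathcal B)\to H_0(X;\mathcal A\otimes\mathcal B)$ be the cap product, where $(\mathcal A\otimes\mathcal B)_x=\mathcal A_x\otimes\mathcal B_x$. Then for every integer $k\ge 0$ there exist a local coefficient system $\mathcal B$ on $X$, whose stalk at $x_0$ is isomorphic as a $\mathbb Z[\pi]$-module to $C_k(\widetilde X)/\operatorname{Im}(\partial_{k+1}: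 C_{k+1}(\widetilde X)\to C_k(\widetilde X))$, and a class $v\in H^k(X;\mathcal B)$ such that, for every local coefficient system $\mathcal A$ on $X$ and every nonzero class $a\in H_k(X;\mathcal A)$, one has $a\cap v\neq 0$ in $H_0(X;\mathcal A\otimes\mathcal B)$. -/

import Mathlib

open CategoryTheory Opposite TensorProduct


universe u w w'

noncomputable section

namespace TwistedCoeff

/-! ### The universal cover of a pointed space -/

/-- The set underlying the universal cover of `(X, x₀)`: homotopy classes (rel endpoints) of paths
in `X` starting at `x₀`. -/
@[ext]
structure UniversalCover {X : Type u} [TopologicalSpace X] (x₀ : X) : Type u where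
  /-- the endpoint of the path -/
  pt : X
  /-- the homotopy class of the path -/
  cls : Path.Homotopic.Quotient x₀ pt

namespace UniversalCover

variable {X : Type u} [TopologicalSpace X] {x₀ : X}

/-- The set of all classes `[γ · η]` with `[γ] = c` and `η` a path inside `U` that starts at the
endpoint of `γ`. -/
def nbhd (c : UniversalCover x₀) (U : Set X) : Set (UniversalCover x₀) :=
  {c' | ∃ η : Path c.pt c'.pt, Set.range η ⊆ U ∧
    c'.cls = c.cls.trans (Path.Homotopic.Quotient.mk η)}

/-- The standard topology of the universal cover, with the sets `nbhd c U`, `U` open, as a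
basis. -/
instance : TopologicalSpace (UniversalCover x₀) :=
  TopologicalSpace.generateFrom {s | ∃ (c : UniversalCover x₀) (U : Set X), IsOpen U ∧ s = nbhd c U}

/-- The covering projection, `[γ] ↦ γ(1)`, is continuous. -/
theorem continuous_pt : Continuous (pt : UniversalCover x₀ → X) := by
  refine continuous_def.2 fun U hU => ?_
  have h : pt ⁻¹' U = ⋃ c ∈ (pt ⁻¹' U : Set (UniversalCover x₀)), nbhd c U := by
    ext c
    simp only [Set.mem_iUnion]
    constructor
    · intro hc
      refine ⟨c, hc, Path.refl c.pt, ?_, ?_⟩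
      · rintro _ ⟨t, rfl⟩
        exact hc
      · exact (Path.Homotopic.Quotient.trans_refl _).symm
    · rintro ⟨d, -, η, hη, -⟩
      exact hη ⟨1, η.target⟩
  rw [h]
  exact isOpen_biUnion fun c _ => TopologicalSpace.isOpen_generateFrom_of_mem ⟨c, U, hU, rfl⟩

/-- The fundamental group acts on the universal cover by deck transformations. Since the product
`g * h` of `FundamentalGroup` is the loop `h` followed by the loop `g`, the left action is
`g • [γ] = [g⁻¹ · γ]`. -/
instance : MulAction (FundamentalGroup X x₀) (UniversalCover x₀) where
  smul g c := ⟨c.pt, (Path.Homotopic.Quotient.symm g.toPath).trans c.cls⟩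
  one_smul c := by
    refine UniversalCover.ext rfl (heq_of_eq ?_)
    change ((1 : FundamentalGroup X x₀)⁻¹).toPath.trans c.cls = c.cls
    rw [inv_one]
    exact Path.Homotopic.Quotient.refl_trans _
  mul_smul g h c := by
    refine UniversalCover.ext rfl (heq_of_eq ?_)
    change ((g * h)⁻¹).toPath.trans c.cls = (g⁻¹).toPath.trans ((h⁻¹).toPath.trans c.cls)
    rw [mul_inv_rev]
    exact Path.Homotopic.Quotient.trans_assoc _ _ _

theorem smul_def (g : FundamentalGroup X x₀) (c : UniversalCover x₀) :
    g • c = ⟨c.pt, (Path.Homotopic.Quotient.symm g.toPath).trans c.cls⟩ := rfl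

theorem smul_mem_nbhd (g : FundamentalGroup X x₀) {c d : UniversalCover x₀} {U : Set X}
    (h : d ∈ nbhd c U) : g • d ∈ nbhd (g • c) U := by
  obtain ⟨η, hη, e⟩ := h
  refine ⟨η, hη, ?_⟩
  change (Path.Homotopic.Quotient.symm g.toPath).trans d.cls =
    ((Path.Homotopic.Quotient.symm g.toPath).trans c.cls).trans _
  rw [e]
  exact (Path.Homotopic.Quotient.trans_assoc _ _ _).symm

instance : ContinuousConstSMul (FundamentalGroup X x₀) (UniversalCover x₀) where
  continuous_const_smul g := by
    refine continuous_generateFrom_iff.2 ?_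
    rintro _ ⟨c, U, hU, rfl⟩
    have h : (fun d : UniversalCover x₀ => g • d) ⁻¹' nbhd c U = nbhd (g⁻¹ • c) U := by
      ext d
      constructor
      · intro hd
        simpa using smul_mem_nbhd g⁻¹ hd
      · intro hd
        simpa using smul_mem_nbhd g hd
    rw [h]
    exact TopologicalSpace.isOpen_generateFrom_of_mem ⟨_, U, hU, rfl⟩

end UniversalCover

/-! ### The singular chain complex, with the action of a group -/

/-- Singular `n`-simplices of `Y`. -/
abbrev Simplex (Y : Type u) [TopologicalSpace Y] (n : ℕ) : Type u :=
  (TopCat.toSSet.obj (TopCat.of Y)).obj (op (SimplexCategory.mk n))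

/-- Singular `n`-chains of `Y`. -/
def Chains (Y : Type u) [TopologicalSpace Y] (n : ℕ) : Type u := FreeAbelianGroup (Simplex Y n)

section chains

variable {Y : Type u} [TopologicalSpace Y]

instance (n : ℕ) : AddCommGroup (Chains Y n) :=
  inferInstanceAs (AddCommGroup (FreeAbelianGroup (Simplex Y n)))

/-- A singular simplex as a chain. -/
def Chains.of {n : ℕ} (σ : Simplex Y n) : Chains Y n := FreeAbelianGroup.of σ

/-- The additive extension of a map defined on simplices. -/
def Chains.lift {n : ℕ} {M : Type*} [AddCommGroup M] (φ : Simplex Y n → M) : Chains Y n →+ M :=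
  FreeAbelianGroup.lift φ

@[simp]
theorem Chains.lift_of {n : ℕ} {M : Type*} [AddCommGroup M] (φ : Simplex Y n → M)
    (σ : Simplex Y n) : Chains.lift φ (Chains.of σ) = φ σ :=
  FreeAbelianGroup.lift_apply_of _ _

@[ext high]
theorem Chains.hom_ext {n : ℕ} {M : Type*} [AddCommGroup M] {φ ψ : Chains Y n →+ M}
    (h : ∀ σ, φ (Chains.of σ) = ψ (Chains.of σ)) : φ = ψ :=
  FreeAbelianGroup.lift_ext _ _ h

/-- The `i`-th face of a singular simplex. -/
def Simplex.face {n : ℕ} (σ : Simplex Y (n + 1)) (i : Fin (n + 2)) : Simplex Y n :=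
  (TopCat.toSSet.obj (TopCat.of Y)).map (SimplexCategory.δ i).op σ

/-- The `i`-th vertex of a singular simplex, as a singular `0`-simplex. -/
def Simplex.vertex {n : ℕ} (σ : Simplex Y n) (i : Fin (n + 1)) : Simplex Y 0 :=
  (TopCat.toSSet.obj (TopCat.of Y)).map (SimplexCategory.const (SimplexCategory.mk 0) (SimplexCategory.mk n) i).op σ

theorem Simplex.vertex_face {n : ℕ} (σ : Simplex Y (n + 1)) (i : Fin (n + 2)) (j : Fin (n + 1)) :
    vertex (face σ i) j = vertex σ (i.succAbove j) := by
  unfold vertex face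
  rw [← ConcreteCategory.comp_apply, ← Functor.map_comp, ← op_comp, SimplexCategory.const_comp]
  rfl

/-- The edge of a singular simplex from its `i`-th vertex to its last vertex. -/
def Simplex.edge {n : ℕ} (σ : Simplex Y n) (i : Fin (n + 1)) : Simplex Y 1 :=
  (TopCat.toSSet.obj (TopCat.of Y)).map
    (SimplexCategory.mkOfLe i (Fin.last n) (Fin.le_last i)).op σ

theorem Simplex.face_zero_edge {n : ℕ} (σ : Simplex Y n) (i : Fin (n + 1)) :
    face (edge σ i) 0 = vertex σ (Fin.last n) := by
  unfold vertex face edge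
  rw [← ConcreteCategory.comp_apply, ← Functor.map_comp, ← op_comp,
    SimplexCategory.δ_zero_eq_const, SimplexCategory.const_comp]
  rfl

theorem Simplex.face_one_edge {n : ℕ} (σ : Simplex Y n) (i : Fin (n + 1)) :
    face (edge σ i) 1 = vertex σ i := by
  unfold vertex face edge
  rw [← ConcreteCategory.comp_apply, ← Functor.map_comp, ← op_comp,
    SimplexCategory.δ_one_eq_const, SimplexCategory.const_comp]
  rfl

/-- The boundary `∂_{n+1} : C_{n+1}(Y) → C_n(Y)`. -/
def boundary (Y : Type u) [TopologicalSpace Y] (n : ℕ) : Chains Y (n + 1) →+ Chains Y n :=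
  Chains.lift fun σ => ∑ i : Fin (n + 2), (-1 : ℤ) ^ (i : ℕ) • Chains.of (Simplex.face σ i)

theorem boundary_of {n : ℕ} (σ : Simplex Y (n + 1)) : boundary Y n (Chains.of σ) =
    ∑ i : Fin (n + 2), (-1 : ℤ) ^ (i : ℕ) • Chains.of (Simplex.face σ i) :=
  Chains.lift_of _ _

theorem boundary_boundary (n : ℕ) (c : Chains Y (n + 2)) :
    boundary Y n (boundary Y (n + 1) c) = 0 := by
  let S : SimplicialObject AddCommGrpCat.{u} :=
    ((SimplicialObject.whiskering _ _).obj AddCommGrpCat.free).obj (TopCat.toSSet.obj (TopCat.of Y))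
  have key : ∀ m, boundary Y m = (AlgebraicTopology.AlternatingFaceMapComplex.objD S m).hom := by
    intro m
    refine Chains.hom_ext fun σ => ?_
    rw [boundary_of]
    have hsum : ∀ {P Q : AddCommGrpCat.{u}} (f : Fin (m + 2) → (P ⟶ Q)) (x : P),
        (∑ i, f i).hom x = ∑ i, (f i).hom x := fun {P Q} f x => by
      change AddCommGrpCat.homAddEquiv (∑ i, f i) x = _
      rw [map_sum, AddMonoidHom.finsetSum_apply]
      rfl
    refine Eq.trans ?_ (hsum (fun i : Fin (m + 2) => (-1 : ℤ) ^ (i : ℕ) • S.δ i) _).symm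
    refine Finset.sum_congr rfl fun i _ => ?_
    refine Eq.trans ?_ (AddMonoidHom.smul_apply _ _ _).symm
    congr 1
  have h := congrArg (fun f => AddCommGrpCat.Hom.hom f c)
    (AlgebraicTopology.AlternatingFaceMapComplex.d_squared S n)
  rw [key, key]
  exact h

variable {G : Type w} [Group G] [MulAction G Y] [ContinuousConstSMul G Y]

/-- Translation of singular simplices by a group element. -/
def Simplex.translate {n : ℕ} (g : G) (σ : Simplex Y n) : Simplex Y n :=
  (TopCat.toSSet.map (TopCat.ofHom ⟨fun y : Y => g • y, continuous_const_smul g⟩)).app (op (SimplexCategory.mk n)) σ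

theorem Simplex.translate_one {n : ℕ} (σ : Simplex Y n) : translate (1 : G) σ = σ := by
  have h : TopCat.ofHom (⟨fun y : Y => (1 : G) • y, continuous_const_smul 1⟩ : C(Y, Y)) =
      𝟙 (TopCat.of Y) := by
    ext y
    exact one_smul G y
  unfold translate
  rw [h, CategoryTheory.Functor.map_id]
  rfl

theorem Simplex.translate_mul {n : ℕ} (g h : G) (σ : Simplex Y n) :
    translate (g * h) σ = translate g (translate h σ) := by
  have e : TopCat.ofHom (⟨fun y : Y => (g * h) • y, continuous_const_smul _⟩ : C(Y, Y)) =
      TopCat.ofHom (⟨fun y : Y => h • y, continuous_const_smul _⟩ : C(Y, Y)) ≫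
        TopCat.ofHom (⟨fun y : Y => g • y, continuous_const_smul _⟩ : C(Y, Y)) := by
    ext y
    exact mul_smul g h y
  unfold translate
  rw [e, CategoryTheory.Functor.map_comp]
  rfl

theorem Simplex.face_translate {n : ℕ} (g : G) (σ : Simplex Y (n + 1)) (i : Fin (n + 2)) :
    face (translate g σ) i = translate g (face σ i) :=
  (NatTrans.naturality_apply (TopCat.toSSet.map (TopCat.ofHom
    (⟨fun y : Y => g • y, continuous_const_smul g⟩ : C(Y, Y)))) (SimplexCategory.δ i).op σ).symm

theorem Simplex.vertex_translate {n : ℕ} (g : G) (σ : Simplex Y n) (i : Fin (n + 1)) :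
    vertex (translate g σ) i = translate g (vertex σ i) :=
  (NatTrans.naturality_apply (TopCat.toSSet.map (TopCat.ofHom
    (⟨fun y : Y => g • y, continuous_const_smul g⟩ : C(Y, Y))))
      (SimplexCategory.const (SimplexCategory.mk 0) (SimplexCategory.mk n) i).op σ).symm

instance (n : ℕ) : DistribMulAction G (Chains Y n) where
  smul g c := Chains.lift (fun σ => Chains.of (σ.translate g)) c
  one_smul c := by
    change Chains.lift (fun σ => Chains.of (σ.translate (1 : G))) c = AddMonoidHom.id _ c
    congr 1
    ext σ
    simp [Simplex.translate_one]
  mul_smul g h c := by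
    change Chains.lift (fun σ => Chains.of (σ.translate (g * h))) c =
      ((Chains.lift (fun σ => Chains.of (σ.translate g))).comp
        (Chains.lift (fun σ => Chains.of (σ.translate h)))) c
    congr 1
    ext σ
    simp [Simplex.translate_mul]
  smul_zero g := map_zero _
  smul_add g := map_add _

@[simp]
theorem smul_of {n : ℕ} (g : G) (σ : Simplex Y n) :
    g • Chains.of σ = Chains.of (σ.translate g) :=
  Chains.lift_of _ _

theorem boundary_smul {n : ℕ} (g : G) (c : Chains Y (n + 1)) :
    boundary Y n (g • c) = g • boundary Y n c := by
  change ((boundary Y n).comp (DistribSMul.toAddMonoidHom _ g)) c =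
    ((DistribSMul.toAddMonoidHom _ g).comp (boundary Y n)) c
  congr 1
  ext σ
  simp only [AddMonoidHom.comp_apply, DistribSMul.toAddMonoidHom_apply, smul_of, boundary_of,
    Simplex.face_translate, Finset.smul_sum, smul_comm g ((-1 : ℤ) ^ _)]

end chains

/-! ### Homology of complexes of abelian groups -/

/-- The cycles of a chain complex `⋯ → K 2 → K 1 → K 0 → 0`. -/
def cycles {K : ℕ → Type*} [∀ n, AddCommGroup (K n)] (d : ∀ n, K (n + 1) →+ K n) :
    ∀ n, AddSubgroup (K n)
  | 0 => ⊤
  | n + 1 => (d n).ker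

/-- The homology `ker / im` of a chain complex `⋯ → K 2 → K 1 → K 0 → 0`. -/
abbrev Homology {K : ℕ → Type*} [∀ n, AddCommGroup (K n)] (d : ∀ n, K (n + 1) →+ K n) (n : ℕ) :=
  cycles d n ⧸ (d n).range.addSubgroupOf (cycles d n)

/-- The coboundaries of a cochain complex `0 → K 0 → K 1 → K 2 → ⋯`. -/
def coboundaries {K : ℕ → Type*} [∀ n, AddCommGroup (K n)] (δ : ∀ n, K n →+ K (n + 1)) :
    ∀ n, AddSubgroup (K n)
  | 0 => ⊥
  | n + 1 => (δ n).range

/-- The cohomology `ker / im` of a cochain complex `0 → K 0 → K 1 → K 2 → ⋯`. -/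
abbrev Cohomology {K : ℕ → Type*} [∀ n, AddCommGroup (K n)] (δ : ∀ n, K n →+ K (n + 1)) (n : ℕ) :=
  (δ n).ker ⧸ (coboundaries δ n).addSubgroupOf (δ n).ker

/-! ### `Hom` and `⊗` over a group ring -/

section modules

variable (G : Type w) [Group G]

/-- The group `Hom_{ℤ[G]}(C, N)` of additive maps that commute with the action of `G`. -/
def EquivHom (C N : Type*) [AddCommGroup C] [DistribMulAction G C] [AddCommGroup N]
    [DistribMulAction G N] : AddSubgroup (C →+ N) where
  carrier := {f | ∀ (g : G) (c : C), f (g • c) = g • f c}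
  zero_mem' g c := (smul_zero g).symm
  add_mem' {f f'} hf hf' g c := by
    simp only [AddMonoidHom.add_apply, hf g c, hf' g c, smul_add]
  neg_mem' {f} hf g c := by
    simp only [AddMonoidHom.neg_apply, hf g c, smul_neg]

/-- The relations `m g ⊗ c = m ⊗ g c`, where `m g = g⁻¹ m`. -/
def balancing (M C : Type*) [AddCommGroup M] [DistribMulAction G M] [AddCommGroup C]
    [DistribMulAction G C] : AddSubgroup (M ⊗[ℤ] C) :=
  AddSubgroup.closure {t | ∃ (g : G) (m : M) (c : C), t = (g⁻¹ • m) ⊗ₜ[ℤ] c - m ⊗ₜ[ℤ] (g • c)}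

/-- The tensor product `M ⊗_{ℤ[G]} C` of two left `ℤ[G]`-modules, where `M` is made into a right
module by `m g = g⁻¹ m`. -/
abbrev GTensor (M C : Type*) [AddCommGroup M] [DistribMulAction G M] [AddCommGroup C]
    [DistribMulAction G C] := (M ⊗[ℤ] C) ⧸ balancing G M C

variable {G} {M C C' N : Type*} [AddCommGroup M] [DistribMulAction G M]
  [AddCommGroup C] [DistribMulAction G C] [AddCommGroup C'] [DistribMulAction G C']
  [AddCommGroup N] [DistribMulAction G N]

/-- The pure tensor `m ⊗ c` in `M ⊗_{ℤ[G]} C`. -/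
def gtmul (m : M) (c : C) : GTensor G M C := QuotientAddGroup.mk (m ⊗ₜ[ℤ] c)

/-- A balanced biadditive map induces a map on `M ⊗_{ℤ[G]} C`. -/
def GTensor.lift {P : Type*} [AddCommGroup P] (φ : M →+ C →+ P)
    (h : ∀ (g : G) m c, φ (g⁻¹ • m) c = φ m (g • c)) : GTensor G M C →+ P :=
  QuotientAddGroup.lift (balancing G M C)
    (TensorProduct.liftAddHom φ fun r m c => by simp)
    (by
      refine (AddSubgroup.closure_le _).2 ?_
      rintro _ ⟨g, m, c, rfl⟩
      simp [h])

@[simp]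
theorem GTensor.lift_gtmul {P : Type*} [AddCommGroup P] (φ : M →+ C →+ P)
    (h : ∀ (g : G) m c, φ (g⁻¹ • m) c = φ m (g • c)) (m : M) (c : C) :
    GTensor.lift φ h (gtmul m c) = φ m c := rfl

theorem gtmul_add (m : M) (c c' : C) :
    (gtmul m (c + c') : GTensor G M C) = gtmul m c + gtmul m c' :=
  congrArg QuotientAddGroup.mk (TensorProduct.tmul_add m c c')

theorem add_gtmul (m m' : M) (c : C) :
    (gtmul (m + m') c : GTensor G M C) = gtmul m c + gtmul m' c :=
  congrArg QuotientAddGroup.mk (TensorProduct.add_tmul m m' c)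

theorem smul_gtmul (g : G) (m : M) (c : C) :
    (gtmul (g⁻¹ • m) c : GTensor G M C) = gtmul m (g • c) :=
  (QuotientAddGroup.eq_iff_sub_mem (N := balancing G M C)).2
    (AddSubgroup.subset_closure ⟨g, m, c, rfl⟩)

/-- `(m, c) ↦ m ⊗ c` as a biadditive map. -/
def gtmulHom (G : Type w) [Group G] (M C : Type*) [AddCommGroup M] [DistribMulAction G M]
    [AddCommGroup C] [DistribMulAction G C] : M →+ C →+ GTensor G M C :=
  AddMonoidHom.mk' (fun m => AddMonoidHom.mk' (fun c => gtmul m c) (gtmul_add m))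
    (fun m m' => by ext c; exact add_gtmul m m' c)

@[simp]
theorem gtmulHom_apply (m : M) (c : C) : gtmulHom G M C m c = gtmul m c := rfl

theorem GTensor.hom_ext {P : Type*} [AddCommGroup P] {φ ψ : GTensor G M C →+ P}
    (h : ∀ m, φ.comp (gtmulHom G M C m) = ψ.comp (gtmulHom G M C m)) : φ = ψ := by
  refine AddMonoidHom.ext fun x => ?_
  obtain ⟨t, rfl⟩ := QuotientAddGroup.mk_surjective x
  induction t using TensorProduct.induction_on with
  | zero => exact (map_zero φ).trans (map_zero ψ).symm
  | tmul m c => exact DFunLike.congr_fun (h m) c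
  | add s t hs ht => rw [QuotientAddGroup.mk_add, map_add, map_add, hs, ht]

end modules

/-! ### Local coefficient systems -/

/-- A local coefficient system on `X`: a functor from the fundamental groupoid of `X` to abelian
groups. -/
abbrev LocalSystem (X : Type u) [TopologicalSpace X] := FundamentalGroupoid X ⥤ AddCommGrpCat.{w}

namespace LocalSystem

variable {X : Type u} [TopologicalSpace X]

/-- The tensor product of local systems, `(𝓐 ⊗ 𝓑)_x = 𝓐_x ⊗ 𝓑_x`. -/
def tensor (𝓐 : LocalSystem.{u, w} X) (𝓑 : LocalSystem.{u, w'} X) :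
    LocalSystem.{u, max w w'} X where
  obj x := AddCommGrpCat.of (𝓐.obj x ⊗[ℤ] 𝓑.obj x)
  map α := AddCommGrpCat.ofHom (TensorProduct.map (𝓐.map α).hom.toIntLinearMap
    (𝓑.map α).hom.toIntLinearMap).toAddMonoidHom
  map_id x := by
    ext t
    induction t using TensorProduct.induction_on with
    | zero => simp
    | tmul a b => simp
    | add s t hs ht => rw [map_add, map_add, hs, ht]
  map_comp α β := by
    ext t
    induction t using TensorProduct.induction_on with
    | zero => simp
    | tmul a b => simp
    | add s t hs ht => rw [map_add, map_add, hs, ht]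

/-- The stalk of a local system at the base point. -/
def Stalk (𝓐 : LocalSystem.{u, w} X) (x₀ : X) : Type w := 𝓐.obj (FundamentalGroupoid.mk x₀)

instance (𝓐 : LocalSystem.{u, w} X) (x₀ : X) : AddCommGroup (𝓐.Stalk x₀) :=
  inferInstanceAs (AddCommGroup (𝓐.obj (FundamentalGroupoid.mk x₀)))

/-- The natural action of the fundamental group on the stalk. -/
instance (𝓐 : LocalSystem.{u, w} X) (x₀ : X) :
    DistribMulAction (FundamentalGroup X x₀) (𝓐.Stalk x₀) where
  smul g a := (𝓐.map g.toArrow).hom a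
  one_smul a := by
    change (𝓐.map (𝟙 (FundamentalGroupoid.mk x₀))).hom a = a
    rw [CategoryTheory.Functor.map_id]
    rfl
  mul_smul g h a := by
    change (𝓐.map (h.toArrow ≫ g.toArrow)).hom a = _
    rw [CategoryTheory.Functor.map_comp]
    rfl
  smul_zero g := map_zero (𝓐.map g.toArrow).hom
  smul_add g := map_add (𝓐.map g.toArrow).hom

/-- The biadditive map `(a, b) ↦ a ⊗ b` on stalks. -/
def stalkTmul (𝓐 : LocalSystem.{u, w} X) (𝓑 : LocalSystem.{u, w'} X) (x₀ : X) :
    𝓐.Stalk x₀ →+ 𝓑.Stalk x₀ →+ (𝓐.tensor 𝓑).Stalk x₀ :=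
  AddMonoidHom.mk' (fun a => AddMonoidHom.mk'
    (fun b => (TensorProduct.tmul ℤ a b :
      𝓐.obj (FundamentalGroupoid.mk x₀) ⊗[ℤ] 𝓑.obj (FundamentalGroupoid.mk x₀)))
    (fun b b' => TensorProduct.tmul_add _ _ _))
    (fun a a' => by ext b; exact TensorProduct.add_tmul _ _ _)

theorem smul_stalkTmul (𝓐 : LocalSystem.{u, w} X) (𝓑 : LocalSystem.{u, w'} X) (x₀ : X)
    (g : FundamentalGroup X x₀) (a : 𝓐.Stalk x₀) (b : 𝓑.Stalk x₀) :
    g • stalkTmul 𝓐 𝓑 x₀ a b = stalkTmul 𝓐 𝓑 x₀ (g • a) (g • b) := rfl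

/-! ### Homology and cohomology with local coefficients -/

variable (𝓐 : LocalSystem.{u, w} X) (𝓑 : LocalSystem.{u, w'} X) (x₀ : X)

/-- The chain group `A ⊗_{ℤ[π]} C_n(X̃)`, where `A` is the stalk of `𝓐`. -/
abbrev TwChains (n : ℕ) : Type (max u w) :=
  GTensor (FundamentalGroup X x₀) (𝓐.Stalk x₀) (Chains (UniversalCover x₀) n)

/-- The differential `1 ⊗ ∂`. -/
def twBoundary (n : ℕ) : 𝓐.TwChains x₀ (n + 1) →+ 𝓐.TwChains x₀ n :=
  GTensor.lift
    (AddMonoidHom.mk' (fun a => AddMonoidHom.mk'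
      (fun c => gtmul a (boundary (UniversalCover x₀) n c))
      (fun c c' => by simp only [map_add, gtmul_add]))
      (fun a a' => by ext σ; exact add_gtmul _ _ _))
    (fun g a c => by
      simp only [AddMonoidHom.mk'_apply, boundary_smul, smul_gtmul])

theorem twBoundary_gtmul (n : ℕ) (a : 𝓐.Stalk x₀) (c : Chains (UniversalCover x₀) (n + 1)) :
    𝓐.twBoundary x₀ n (gtmul a c) = gtmul a (boundary (UniversalCover x₀) n c) := rfl

theorem twBoundary_twBoundary (n : ℕ) (c : 𝓐.TwChains x₀ (n + 2)) :
    𝓐.twBoundary x₀ n (𝓐.twBoundary x₀ (n + 1) c) = 0 := by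
  suffices h : (𝓐.twBoundary x₀ n).comp (𝓐.twBoundary x₀ (n + 1)) = 0 from DFunLike.congr_fun h c
  refine GTensor.hom_ext fun a => AddMonoidHom.ext fun c => ?_
  change gtmul a (boundary _ n (boundary _ (n + 1) c)) = 0
  rw [boundary_boundary, ← gtmulHom_apply, map_zero]

/-- The homology `H_n(X; 𝓐) = H_n(A ⊗_{ℤ[π]} C_*(X̃))`. -/
abbrev TwHomology (n : ℕ) : Type (max u w) := Homology (𝓐.twBoundary x₀) n

/-- The cochain group `Hom_{ℤ[π]}(C_n(X̃), B)`, where `B` is the stalk of `𝓑`. -/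
abbrev TwCochains (n : ℕ) : AddSubgroup (Chains (UniversalCover x₀) n →+ 𝓑.Stalk x₀) :=
  EquivHom (FundamentalGroup X x₀) (Chains (UniversalCover x₀) n) (𝓑.Stalk x₀)

/-- The coboundary `δ f = f ∘ ∂`. -/
def twCoboundary (n : ℕ) : 𝓑.TwCochains x₀ n →+ 𝓑.TwCochains x₀ (n + 1) :=
  AddMonoidHom.mk' (fun f => ⟨f.1.comp (boundary (UniversalCover x₀) n), fun g c => by
      rw [AddMonoidHom.comp_apply, boundary_smul, f.2]; rfl⟩)
    (fun _ _ => rfl)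

theorem twCoboundary_twCoboundary (n : ℕ) (f : 𝓑.TwCochains x₀ n) :
    𝓑.twCoboundary x₀ (n + 1) (𝓑.twCoboundary x₀ n f) = 0 := by
  refine Subtype.ext (AddMonoidHom.ext fun c => ?_)
  change f.1 (boundary _ n (boundary _ (n + 1) c)) = 0
  rw [boundary_boundary, map_zero]

/-- The cohomology `H^n(X; 𝓑) = H^n(Hom_{ℤ[π]}(C_*(X̃), B))`. -/
abbrev TwCohomology (n : ℕ) : Type (max u w') := Cohomology (𝓑.twCoboundary x₀) n

/-! ### The cap product `H_k(X; 𝓐) ⊗ H^k(X; 𝓑) → H_0(X; 𝓐 ⊗ 𝓑)` -/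

variable {𝓐 𝓑 x₀}

/-- The cap product of chains with a `k`-cochain in degree `k`: the front `k`-face of a `k`-simplex
is the simplex itself and the back `0`-face is its last vertex, so
`(a ⊗ σ) ∩ f = (a ⊗ f σ) ⊗ σ(e_k)`. -/
def capChain {k : ℕ} (f : 𝓑.TwCochains x₀ k) :
    𝓐.TwChains x₀ k →+ (𝓐.tensor 𝓑).TwChains x₀ 0 :=
  GTensor.lift
    (AddMonoidHom.mk' (fun a => Chains.lift fun σ =>
        gtmul (stalkTmul 𝓐 𝓑 x₀ a (f.1 (Chains.of σ))) (Chains.of (σ.vertex (Fin.last k))))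
      (fun a a' => by
        ext σ
        simp only [AddMonoidHom.add_apply, Chains.lift_of, map_add, add_gtmul]))
    (fun g a c => by
      simp only [AddMonoidHom.mk'_apply]
      rw [← DistribSMul.toAddMonoidHom_apply (Chains (UniversalCover x₀) k) g c,
        ← AddMonoidHom.comp_apply]
      congr 1
      ext σ
      simp only [AddMonoidHom.comp_apply, DistribSMul.toAddMonoidHom_apply, smul_of,
        Chains.lift_of, Simplex.vertex_translate]
      rw [← smul_of g (σ.vertex _), ← smul_gtmul, smul_stalkTmul, ← smul_of g σ, f.2,
        inv_smul_smul])

theorem capChain_gtmul_of {k : ℕ} (f : 𝓑.TwCochains x₀ k) (a : 𝓐.Stalk x₀)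
    (σ : Simplex (UniversalCover x₀) k) :
    capChain f (gtmul a (Chains.of σ) : 𝓐.TwChains x₀ k) =
      gtmul (stalkTmul 𝓐 𝓑 x₀ a (f.1 (Chains.of σ))) (Chains.of (σ.vertex (Fin.last k))) := by
  rw [capChain, GTensor.lift_gtmul]
  exact Chains.lift_of _ _

theorem capChain_add {k : ℕ} (f f' : 𝓑.TwCochains x₀ k) :
    (capChain (f + f') : 𝓐.TwChains x₀ k →+ _) = capChain f + capChain f' := by
  refine GTensor.hom_ext fun a => Chains.hom_ext fun σ => ?_
  simp only [AddMonoidHom.comp_apply, gtmulHom_apply, AddMonoidHom.add_apply, capChain_gtmul_of]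
  rw [← add_gtmul, ← map_add]
  rfl

theorem capChain_zero {k : ℕ} :
    (capChain (0 : 𝓑.TwCochains x₀ k) : 𝓐.TwChains x₀ k →+ _) = 0 := by
  have h := capChain_add (𝓐 := 𝓐) (0 : 𝓑.TwCochains x₀ k) 0
  rw [add_zero] at h
  exact left_eq_add.1 h

/-- The class in `H_0` of a `0`-chain. -/
def zeroClass (𝓐 : LocalSystem.{u, w} X) (x₀ : X) : 𝓐.TwChains x₀ 0 →+ 𝓐.TwHomology x₀ 0 :=
  AddMonoidHom.mk' (fun c => QuotientAddGroup.mk ⟨c, AddSubgroup.mem_top c⟩) (fun _ _ => rfl)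

theorem zeroClass_boundary (c : 𝓐.TwChains x₀ 1) : zeroClass 𝓐 x₀ (𝓐.twBoundary x₀ 0 c) = 0 :=
  (QuotientAddGroup.eq_zero_iff _).2 ⟨c, rfl⟩

theorem zeroClass_vertex {n : ℕ} (a : 𝓐.Stalk x₀) (τ : Simplex (UniversalCover x₀) n)
    (i : Fin (n + 1)) : zeroClass 𝓐 x₀ (gtmul a (Chains.of (τ.vertex i))) =
      zeroClass 𝓐 x₀ (gtmul a (Chains.of (τ.vertex (Fin.last n)))) := by
  have h := zeroClass_boundary (𝓐 := 𝓐) (gtmul a (Chains.of (τ.edge i)))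
  rw [twBoundary_gtmul, boundary_of, Fin.sum_univ_two, Simplex.face_zero_edge,
    Simplex.face_one_edge, gtmul_add, map_add, ← gtmulHom_apply, ← gtmulHom_apply, map_zsmul,
    map_zsmul, map_zsmul, map_zsmul] at h
  simp only [Fin.val_zero, pow_zero, one_smul, Fin.val_one, pow_one, neg_smul,
    gtmulHom_apply] at h
  exact (add_neg_eq_zero.1 h).symm

theorem zeroClass_capChain_boundary {k : ℕ} (f : 𝓑.TwCochains x₀ k)
    (c : 𝓐.TwChains x₀ (k + 1)) :
    zeroClass (𝓐.tensor 𝓑) x₀ (capChain f (𝓐.twBoundary x₀ k c)) =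
      zeroClass (𝓐.tensor 𝓑) x₀ (capChain (𝓑.twCoboundary x₀ k f) c) := by
  let φ := ((zeroClass (𝓐.tensor 𝓑) x₀).comp (capChain f)).comp (𝓐.twBoundary x₀ k)
  let ψ := (zeroClass (𝓐.tensor 𝓑) x₀).comp
    (capChain (𝓐 := 𝓐) (𝓑.twCoboundary x₀ k f))
  suffices h : φ = ψ from DFunLike.congr_fun h c
  refine GTensor.hom_ext fun a => Chains.hom_ext fun τ => ?_
  simp only [φ, ψ, AddMonoidHom.comp_apply, gtmulHom_apply, capChain_gtmul_of, twBoundary_gtmul]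
  change _ = zeroClass (𝓐.tensor 𝓑) x₀ (gtmul (stalkTmul 𝓐 𝓑 x₀ a
    (f.1 (boundary (UniversalCover x₀) k (Chains.of τ)))) _)
  simp only [boundary_of, map_sum, map_zsmul, ← gtmulHom_apply, AddMonoidHom.finsetSum_apply,
    AddMonoidHom.smul_apply]
  refine Finset.sum_congr rfl fun i _ => ?_
  simp only [gtmulHom_apply, capChain_gtmul_of]
  rw [Simplex.vertex_face, zeroClass_vertex]

/-- The class of `z ∩ f` vanishes if `z` is a boundary and `f` is a cocycle. -/
theorem zeroClass_cap_eq_zero_left {k : ℕ} (z : 𝓐.TwChains x₀ k)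
    (hz : z ∈ (𝓐.twBoundary x₀ k).range) (f : 𝓑.TwCochains x₀ k)
    (hf : f ∈ (𝓑.twCoboundary x₀ k).ker) : zeroClass (𝓐.tensor 𝓑) x₀ (capChain f z) = 0 := by
  obtain ⟨c, rfl⟩ := hz
  rw [zeroClass_capChain_boundary, AddMonoidHom.mem_ker.1 hf, capChain_zero,
    AddMonoidHom.zero_apply, map_zero]

/-- The class of `z ∩ f` vanishes if `z` is a cycle and `f` is a coboundary. -/
theorem zeroClass_cap_eq_zero_right {k : ℕ} (z : 𝓐.TwChains x₀ k)
    (hz : z ∈ cycles (𝓐.twBoundary x₀) k) (f : 𝓑.TwCochains x₀ k)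
    (hf : f ∈ coboundaries (𝓑.twCoboundary x₀) k) :
    zeroClass (𝓐.tensor 𝓑) x₀ (capChain f z) = 0 := by
  cases k with
  | zero =>
    rw [show f = 0 from AddSubgroup.mem_bot.1 hf, capChain_zero, AddMonoidHom.zero_apply, map_zero]
  | succ k =>
    obtain ⟨h, rfl⟩ := hf
    rw [← zeroClass_capChain_boundary, show 𝓐.twBoundary x₀ k z = 0 from hz, map_zero, map_zero]

/-- The cap product of a fixed `k`-cycle with classes in `H^k(X; 𝓑)`. -/
def capCycle {k : ℕ} (z : cycles (𝓐.twBoundary x₀) k) :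
    𝓑.TwCohomology x₀ k →+ (𝓐.tensor 𝓑).TwHomology x₀ 0 :=
  QuotientAddGroup.lift _
    (AddMonoidHom.mk' (fun f => zeroClass (𝓐.tensor 𝓑) x₀ (capChain f.1 z.1))
      (fun f f' => by
        rw [AddSubgroup.coe_add, capChain_add, AddMonoidHom.add_apply, map_add]))
    (fun f hf => zeroClass_cap_eq_zero_right z.1 z.2 f.1 (AddSubgroup.mem_addSubgroupOf.1 hf))

theorem capCycle_mk {k : ℕ} (z : cycles (𝓐.twBoundary x₀) k) (f : (𝓑.twCoboundary x₀ k).ker) :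
    capCycle z (QuotientAddGroup.mk f : 𝓑.TwCohomology x₀ k) =
      zeroClass (𝓐.tensor 𝓑) x₀ (capChain f.1 z.1) := rfl

/-- The cap product `∩ : H_k(X; 𝓐) ⊗ H^k(X; 𝓑) → H_0(X; 𝓐 ⊗ 𝓑)`, given on representatives by
`[z] ∩ [f] = [z ∩ f]`. -/
def cap {k : ℕ} :
    𝓐.TwHomology x₀ k →+ 𝓑.TwCohomology x₀ k →+ (𝓐.tensor 𝓑).TwHomology x₀ 0 :=
  QuotientAddGroup.lift _
    (AddMonoidHom.mk' (fun z => capCycle z)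
      (fun z z' => by
        refine AddMonoidHom.ext fun v => ?_
        obtain ⟨f, rfl⟩ := QuotientAddGroup.mk_surjective v
        rw [AddMonoidHom.add_apply, capCycle_mk, capCycle_mk, capCycle_mk, AddSubgroup.coe_add,
          map_add, map_add]))
    (fun z hz => by
      refine AddMonoidHom.ext fun v => ?_
      obtain ⟨f, rfl⟩ := QuotientAddGroup.mk_surjective v
      exact zeroClass_cap_eq_zero_left z.1 (AddSubgroup.mem_addSubgroupOf.1 hz) f.1 f.2)

/-- On representatives, the cap product is `[z] ∩ [f] = [z ∩ f]`. -/
theorem cap_mk {k : ℕ} (z : cycles (𝓐.twBoundary x₀) k) (f : (𝓑.twCoboundary x₀ k).ker) :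
    cap (QuotientAddGroup.mk z : 𝓐.TwHomology x₀ k)
      (QuotientAddGroup.mk f : 𝓑.TwCohomology x₀ k) =
      zeroClass (𝓐.tensor 𝓑) x₀ (capChain f.1 z.1) := rfl

end LocalSystem

end TwistedCoeff

end

/-! Write C for the singular chains of the universal cover, let B = C_k / Im ∂_{k+1}, and let v be
the class of the projection C_k → B, which is a cocycle because it kills boundaries. For z = Σ a_i ⊗
σ_i, the product z ∩ v is represented by Σ (a_i ⊗ [σ_i]) ⊗ (last vertex of σ_i), so nothing is lost
except what boundaries account for.

To make this precise, capping with v is given a left inverse with values in (A ⊗_{ℤ[π]} C_k) / Im(1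
⊗ ∂_{k+1}), a group that contains H_k(X; 𝓐). Augmenting C₀ sends H_0(X; 𝓐 ⊗ 𝓑) to the coinvariants
of A ⊗ B under the diagonal action, that is, to A ⊗_{ℤ[π]} B, and a ⊗ [c] ↦ [a ⊗ c] goes on to the
cokernel. On chains the composite is `zeroChainsToCokernel`. It kills boundaries
(`zeroChainsToCokernel_twBoundary`) and sends z ∩ v to the class of z
(`zeroChainsToCokernel_capChain`). Hence a ∩ v = 0 forces z to be a boundary.

That the module B is the stalk of a local system is `exists_stalk_equiv`; path-connectedness enters
there. -/

noncomputable section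

namespace TwistedCoeff

/-! ### The augmentation of singular 0-chains -/

section augmentation

variable {Y : Type u} [TopologicalSpace Y]

/-- The augmentation `C₀(Y) → ℤ`, with value `1` on every `0`-simplex. -/
def augmentation (Y : Type u) [TopologicalSpace Y] : Chains Y 0 →+ ℤ :=
  Chains.lift fun _ => 1

@[simp]
theorem augmentation_of (σ : Simplex Y 0) : augmentation Y (Chains.of σ) = 1 :=
  Chains.lift_of _ _

/-- The two endpoints of an edge enter with opposite signs. This is what lets maps built from the
augmentation descend to `H_0`. -/
theorem augmentation_boundary (c : Chains Y 1) : augmentation Y (boundary Y 0 c) = 0 := by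
  suffices h : (augmentation Y).comp (boundary Y 0) = 0 from DFunLike.congr_fun h c
  ext σ
  simp [boundary_of, Fin.sum_univ_two]

theorem augmentation_smul {G : Type w} [Group G] [MulAction G Y] [ContinuousConstSMul G Y]
    (g : G) (c : Chains Y 0) : augmentation Y (g • c) = augmentation Y c := by
  suffices h : (augmentation Y).comp (DistribSMul.toAddMonoidHom _ g) = augmentation Y from
    DFunLike.congr_fun h c
  ext σ
  simp

end augmentation

/-! ### From modules over the fundamental group to local systems -/

/-- The induced action on the quotient by a stable subgroup. -/
abbrev quotientDistribMulAction {G : Type w} [Group G] {C : Type*} [AddCommGroup C]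
    [DistribMulAction G C] (N : AddSubgroup C) (hN : ∀ (g : G), ∀ c ∈ N, g • c ∈ N) :
    DistribMulAction G (C ⧸ N) where
  smul g := QuotientAddGroup.map N N (DistribSMul.toAddMonoidHom C g) (hN g)
  one_smul q := by
    obtain ⟨c, rfl⟩ := QuotientAddGroup.mk_surjective q
    exact congrArg QuotientAddGroup.mk (one_smul G c)
  mul_smul g h q := by
    obtain ⟨c, rfl⟩ := QuotientAddGroup.mk_surjective q
    exact congrArg QuotientAddGroup.mk (mul_smul g h c)
  smul_zero g := map_zero (QuotientAddGroup.map N N (DistribSMul.toAddMonoidHom C g) (hN g))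
  smul_add g := map_add (QuotientAddGroup.map N N (DistribSMul.toAddMonoidHom C g) (hN g))

namespace LocalSystem

variable {X : Type u} [TopologicalSpace X]

/-- The local system with stalk `M` associated with a module over the fundamental group and a
choice of paths to the base point. -/
def ofModule {x₀ : X} (M : Type w) [AddCommGroup M] [DistribMulAction (FundamentalGroup X x₀) M]
    (p : ∀ x : FundamentalGroupoid X, x ⟶ FundamentalGroupoid.mk x₀) : LocalSystem.{u, w} X where
  obj _ := AddCommGrpCat.of M
  map {x y} α := AddCommGrpCat.ofHom
    (DistribSMul.toAddMonoidHom M (FundamentalGroup.fromArrow (Groupoid.inv (p x) ≫ α ≫ p y)))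
  map_id x := by
    ext m
    change FundamentalGroup.fromArrow (Groupoid.inv (p x) ≫ 𝟙 x ≫ p x) • m = m
    rw [Category.id_comp, Groupoid.inv_comp]
    exact one_smul (FundamentalGroup X x₀) m
  map_comp {x y z} α β := by
    ext m
    change FundamentalGroup.fromArrow (Groupoid.inv (p x) ≫ (α ≫ β) ≫ p z) • m =
      FundamentalGroup.fromArrow (Groupoid.inv (p y) ≫ β ≫ p z) •
        FundamentalGroup.fromArrow (Groupoid.inv (p x) ≫ α ≫ p y) • m
    -- Multiplication in `End` is composition in reverse order, so the product of the two loops runs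
    -- through `p y` and straight back, and this detour cancels.
    rw [← mul_smul, End.mul_def]
    simp

/-- Every module over the fundamental group of a path-connected space is the stalk of a local
system. -/
theorem exists_stalk_equiv [PathConnectedSpace X] (x₀ : X) (M : Type w) [AddCommGroup M]
    [DistribMulAction (FundamentalGroup X x₀) M] :
    ∃ (𝓑 : LocalSystem.{u, w} X) (e : M ≃+ 𝓑.Stalk x₀),
      ∀ (g : FundamentalGroup X x₀) (m : M), e (g • m) = g • e m := by
  let p : ∀ x : FundamentalGroupoid X, x ⟶ FundamentalGroupoid.mk x₀ := fun x =>
    Path.Homotopic.Quotient.mk (PathConnectedSpace.somePath x.as x₀)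
  -- The path chosen at the base point need not be constant, so g acts on the stalk of `ofModule M
  -- p` as q g q⁻¹ acts on M. The map m ↦ q m, rather than the identity, is therefore the
  -- equivariant isomorphism.
  let q : FundamentalGroup X x₀ := p (FundamentalGroupoid.mk x₀)
  refine ⟨ofModule M p, DistribMulAction.toAddEquiv M q, fun g m => ?_⟩
  change q • g • m =
    FundamentalGroup.fromArrow (Groupoid.inv q.toArrow ≫ g.toArrow ≫ q.toArrow) • q • m
  rw [← mul_smul, ← mul_smul, End.mul_def, End.mul_def]
  simp

/-! ### The universal class and a left inverse to capping with it -/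

variable {x₀ : X} {𝓐 : LocalSystem.{u, w} X} {𝓑 : LocalSystem.{u, w'} X} {k : ℕ}

/-- Tensor induction, restated because `Stalk` hides the underlying tensor product; hence the
explicit motive. -/
theorem stalk_tensor_hom_ext {P : Type*} [AddCommGroup P] {φ ψ : (𝓐.tensor 𝓑).Stalk x₀ →+ P}
    (h : ∀ a b, φ (stalkTmul 𝓐 𝓑 x₀ a b) = ψ (stalkTmul 𝓐 𝓑 x₀ a b)) : φ = ψ := by
  refine AddMonoidHom.ext fun t => ?_
  refine TensorProduct.induction_on (motive := fun t : 𝓐.obj (FundamentalGroupoid.mk x₀) ⊗[ℤ]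
    𝓑.obj (FundamentalGroupoid.mk x₀) => φ t = ψ t) t ?_ h fun s t hs ht => ?_
  · exact (map_zero φ).trans (map_zero ψ).symm
  · exact (map_add φ _ _).trans ((congrArg₂ _ hs ht).trans (map_add ψ _ _).symm)

section universalClass

variable (e : (Chains (UniversalCover x₀) k ⧸ (boundary (UniversalCover x₀) k).range) ≃+
    𝓑.Stalk x₀)
  (he : ∀ (g : FundamentalGroup X x₀) (c : Chains (UniversalCover x₀) k),
    e (QuotientAddGroup.mk (g • c)) = g • e (QuotientAddGroup.mk c))

/-- The projection `C_k → C_k / Im ∂_{k+1}` as a cocycle. -/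
def universalCocycle : (𝓑.twCoboundary x₀ k).ker :=
  ⟨⟨e.toAddMonoidHom.comp (QuotientAddGroup.mk' _), he⟩,
    Subtype.ext (AddMonoidHom.ext fun c => by
      change e (QuotientAddGroup.mk (boundary _ k c)) = 0
      rw [(QuotientAddGroup.eq_zero_iff _).2 (AddMonoidHom.mem_range.2 ⟨c, rfl⟩), map_zero])⟩

theorem universalCocycle_apply (c : Chains (UniversalCover x₀) k) :
    (universalCocycle e he).1.1 c = e (QuotientAddGroup.mk c) := rfl

/-- The biadditive map `(a, [c]) ↦ [a ⊗ c]` from the stalks of `𝓐` and `𝓑` to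
`(A ⊗_{ℤ[π]} C_k) / Im (1 ⊗ ∂_{k+1})`. -/
def stalkPairing (𝓐 : LocalSystem.{u, w} X) :
    𝓐.Stalk x₀ →+ 𝓑.Stalk x₀ →+ 𝓐.TwChains x₀ k ⧸ (𝓐.twBoundary x₀ k).range :=
  AddMonoidHom.mk' (fun a =>
    (QuotientAddGroup.lift (boundary (UniversalCover x₀) k).range
      ((QuotientAddGroup.mk' (𝓐.twBoundary x₀ k).range).comp
        (gtmulHom (FundamentalGroup X x₀) _ _ a)) (by
          rintro _ ⟨c, rfl⟩
          -- a ⊗ ∂c is the twisted boundary of a ⊗ c, by definition.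
          exact (QuotientAddGroup.eq_zero_iff _).2 ⟨gtmul a c, rfl⟩)).comp e.symm.toAddMonoidHom)
    (fun a a' => by
      ext b
      obtain ⟨q, rfl⟩ := e.surjective b
      obtain ⟨c, rfl⟩ := QuotientAddGroup.mk_surjective q
      simp)

theorem stalkPairing_apply (a : 𝓐.Stalk x₀) (c : Chains (UniversalCover x₀) k) :
    stalkPairing e 𝓐 a (e (QuotientAddGroup.mk c)) = QuotientAddGroup.mk (gtmul a c) := by
  simp [stalkPairing]

/-- The map `A ⊗ (C_k / Im ∂_{k+1}) → (A ⊗_{ℤ[π]} C_k) / Im (1 ⊗ ∂_{k+1})`. -/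
def stalkToCokernel (𝓐 : LocalSystem.{u, w} X) :
    (𝓐.tensor 𝓑).Stalk x₀ →+ 𝓐.TwChains x₀ k ⧸ (𝓐.twBoundary x₀ k).range :=
  TensorProduct.liftAddHom (M := 𝓐.obj (FundamentalGroupoid.mk x₀))
    (N := 𝓑.obj (FundamentalGroupoid.mk x₀)) (R := ℤ) (stalkPairing e 𝓐) fun r a b =>
      (DFunLike.congr_fun (map_zsmul (stalkPairing e 𝓐) r a) b).trans
        (map_zsmul (stalkPairing e 𝓐 a) r b).symm

theorem stalkToCokernel_stalkTmul (a : 𝓐.Stalk x₀) (c : Chains (UniversalCover x₀) k) :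
    stalkToCokernel e 𝓐 (stalkTmul 𝓐 𝓑 x₀ a (e (QuotientAddGroup.mk c))) =
      QuotientAddGroup.mk (gtmul a c) :=
  stalkPairing_apply e a c

/-- Over ℤ[π] one has ga ⊗ gc = a ⊗ g⁻¹gc = a ⊗ c, so the diagonal action becomes trivial in the
target. This is the balancing condition needed to tensor with C₀ over ℤ[π]. -/
theorem stalkToCokernel_smul
    (he : ∀ (g : FundamentalGroup X x₀) (c : Chains (UniversalCover x₀) k),
      e (QuotientAddGroup.mk (g • c)) = g • e (QuotientAddGroup.mk c))
    (g : FundamentalGroup X x₀) (t : (𝓐.tensor 𝓑).Stalk x₀) :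
    stalkToCokernel e 𝓐 (g • t) = stalkToCokernel e 𝓐 t := by
  suffices h : (stalkToCokernel e 𝓐).comp (DistribSMul.toAddMonoidHom _ g) =
    stalkToCokernel e 𝓐 from DFunLike.congr_fun h t
  refine stalk_tensor_hom_ext fun a b => ?_
  obtain ⟨q, rfl⟩ := e.surjective b
  obtain ⟨c, rfl⟩ := QuotientAddGroup.mk_surjective q
  rw [AddMonoidHom.comp_apply, DistribSMul.toAddMonoidHom_apply, smul_stalkTmul, ← he,
    stalkToCokernel_stalkTmul, stalkToCokernel_stalkTmul, ← smul_gtmul, inv_smul_smul]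

/-- The map `(A ⊗ B) ⊗_{ℤ[π]} C₀ → (A ⊗_{ℤ[π]} C_k) / Im (1 ⊗ ∂_{k+1})`, `t ⊗ c ↦ ε(c) t`. -/
def zeroChainsToCokernel
    (he : ∀ (g : FundamentalGroup X x₀) (c : Chains (UniversalCover x₀) k),
      e (QuotientAddGroup.mk (g • c)) = g • e (QuotientAddGroup.mk c))
    (𝓐 : LocalSystem.{u, w} X) :
    (𝓐.tensor 𝓑).TwChains x₀ 0 →+ 𝓐.TwChains x₀ k ⧸ (𝓐.twBoundary x₀ k).range :=
  GTensor.lift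
    (AddMonoidHom.mk' (fun t =>
      ((zmultiplesHom _) (stalkToCokernel e 𝓐 t)).comp (augmentation (UniversalCover x₀)))
      (fun t t' => by ext; simp))
    (fun g t c => by simp [stalkToCokernel_smul e he, augmentation_smul])

theorem zeroChainsToCokernel_gtmul (t : (𝓐.tensor 𝓑).Stalk x₀)
    (c : Chains (UniversalCover x₀) 0) :
    zeroChainsToCokernel e he 𝓐 (gtmul t c) =
      augmentation (UniversalCover x₀) c • stalkToCokernel e 𝓐 t := rfl

/-- Only the augmentation of the C₀ factor is seen, and it vanishes on boundaries of 1-chains. -/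
theorem zeroChainsToCokernel_twBoundary (c : (𝓐.tensor 𝓑).TwChains x₀ 1) :
    zeroChainsToCokernel e he 𝓐 ((𝓐.tensor 𝓑).twBoundary x₀ 0 c) = 0 := by
  suffices h : (zeroChainsToCokernel e he 𝓐).comp ((𝓐.tensor 𝓑).twBoundary x₀ 0) = 0 from
    DFunLike.congr_fun h c
  refine GTensor.hom_ext fun t => AddMonoidHom.ext fun c => ?_
  change zeroChainsToCokernel e he 𝓐 (gtmul t (boundary (UniversalCover x₀) 0 c)) = 0
  rw [zeroChainsToCokernel_gtmul, augmentation_boundary]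
  exact zero_zsmul _

/-- On a ⊗ σ the cap product is (a ⊗ [σ]) ⊗ vertex, and a vertex has augmentation 1. The identity
holds for every chain, not just for cycles. -/
theorem zeroChainsToCokernel_capChain (z : 𝓐.TwChains x₀ k) :
    zeroChainsToCokernel e he 𝓐 (capChain (universalCocycle e he).1 z) =
      QuotientAddGroup.mk z := by
  suffices h : (zeroChainsToCokernel e he 𝓐).comp (capChain (universalCocycle e he).1) =
      QuotientAddGroup.mk' (𝓐.twBoundary x₀ k).range from DFunLike.congr_fun h z
  refine GTensor.hom_ext fun a => Chains.hom_ext fun σ => ?_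
  change zeroChainsToCokernel e he 𝓐 (capChain (universalCocycle e he).1
    (gtmul a (Chains.of σ))) = QuotientAddGroup.mk (gtmul a (Chains.of σ))
  rw [capChain_gtmul_of, zeroChainsToCokernel_gtmul, augmentation_of, one_smul,
    universalCocycle_apply, stalkToCokernel_stalkTmul]

theorem cap_universalCocycle_ne_zero (a : 𝓐.TwHomology x₀ k) (ha : a ≠ 0) :
    cap a (QuotientAddGroup.mk (universalCocycle e he) : 𝓑.TwCohomology x₀ k) ≠ 0 := by
  obtain ⟨z, rfl⟩ := QuotientAddGroup.mk_surjective a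
  intro h
  rw [cap_mk] at h
  -- Vanishing in `H_0` makes the representing 0-chain z ∩ v a boundary, the image of some c; the
  -- left inverse turns this into the vanishing of z modulo boundaries.
  obtain ⟨c, hc⟩ := AddSubgroup.mem_addSubgroupOf.1 ((QuotientAddGroup.eq_zero_iff _).1 h)
  have hz := zeroChainsToCokernel_capChain e he z.1
  refine ha ((QuotientAddGroup.eq_zero_iff _).2 (AddSubgroup.mem_addSubgroupOf.2
    ((QuotientAddGroup.eq_zero_iff _).1 (hz.symm.trans ?_))))
  exact (congrArg (zeroChainsToCokernel e he 𝓐) hc.symm).trans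
    (zeroChainsToCokernel_twBoundary e he c)

end universalClass

end LocalSystem

end TwistedCoeff

end

/-! ### Assembling the universal pair -/

theorem propositionl {X : Type u} [TopologicalSpace X] [T2Space X] [PathConnectedSpace X]
    (hX : Nonempty (Topology.CWComplex (Set.univ : Set X))) (x₀ : X) (k : ℕ) :
    ∃ (𝓑 : TwistedCoeff.LocalSystem.{u, u} X) (v : 𝓑.TwCohomology x₀ k),
      (∃ e : (TwistedCoeff.Chains (TwistedCoeff.UniversalCover x₀) k ⧸
          (TwistedCoeff.boundary (TwistedCoeff.UniversalCover x₀) k).range) ≃+ 𝓑.Stalk x₀,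
        ∀ (g : FundamentalGroup X x₀)
          (c : TwistedCoeff.Chains (TwistedCoeff.UniversalCover x₀) k),
          e (QuotientAddGroup.mk (g • c)) = g • e (QuotientAddGroup.mk c)) ∧
      ∀ (𝓐 : TwistedCoeff.LocalSystem.{u, w} X) (a : 𝓐.TwHomology x₀ k),
        a ≠ 0 → TwistedCoeff.LocalSystem.cap a v ≠ 0 := by
  let N := (TwistedCoeff.boundary (TwistedCoeff.UniversalCover x₀) k).range
  let _ : DistribMulAction (FundamentalGroup X x₀)
      (TwistedCoeff.Chains (TwistedCoeff.UniversalCover x₀) k ⧸ N) :=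
    -- The image of ∂ is stable under π because ∂ is equivariant.
    TwistedCoeff.quotientDistribMulAction N (by
      rintro g _ ⟨c, rfl⟩
      exact ⟨g • c, TwistedCoeff.boundary_smul g c⟩)
  obtain ⟨𝓑, e, he⟩ := TwistedCoeff.LocalSystem.exists_stalk_equiv x₀
    (TwistedCoeff.Chains (TwistedCoeff.UniversalCover x₀) k ⧸ N)
  -- Equivariance is expressed through representatives in C_k, so that neither the statement nor the
  -- preceding lemmas refer to the action on the quotient, which is local to this proof.
  have he' : ∀ (g : FundamentalGroup X x₀)
      (c : TwistedCoeff.Chains (TwistedCoeff.UniversalCover x₀) k),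
      e (QuotientAddGroup.mk (g • c)) = g • e (QuotientAddGroup.mk c) := fun g c =>
    he g (QuotientAddGroup.mk c)
  exact ⟨𝓑, QuotientAddGroup.mk (TwistedCoeff.LocalSystem.universalCocycle e he'), ⟨e, he'⟩,
    fun 𝓐 a ha => TwistedCoeff.LocalSystem.cap_universalCocycle_ne_zero e he' a ha⟩
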